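/- Let $G$ be a finite, simple, connected graph with vertex set $V$, let $d$ be its shortest-path distance, and let $R$ be a transit function on $V$, that is, a map $R : V\times V\to 2^V$ with $u\in R(u,v)$, $R(u,v)=R(v,u)$ and $R(u,u)=\{u\}$ for all $u,v\in V$. Let $I_G(u,v)=\{w\in V : d(u,w)+d(w,v)=d(u,v)\}$ be the interval function of $G$. Call $G$ *Ptolemaic* if it is chordal (it has no induced cycle of length greater than $3$) and distance hereditary (in every connected induced subgraph of $G$ the distances are the same as in $G$). Then the following are equivalent: 1. $G$ is Ptolemaic and $R(u,v)=I_G(u,v)$ for all $u,v\in V$; 2. $R$ satisfies the axioms - $(b3)$: for all $u,v,x,y\in V$, if $x\in R(u,v)$ and $y\in R(u,x)$, then $x\in R(y,v)$; - $(J0)$: for all pairwise distinct $u,v,x,y\in V$, if $x\in R(u,y)$ and $y\in R(x,v)$, then $x\in R(u,v)$; - $(J2)$: for all $u,v,x\in V$, if $R(u,x)=\{u,x\}$, $R(x,v)=\{x,v\}$ and $R(u,v)\neq\{u,v\}$, then $x\in R(u,v)$; and, for all distinct $u,v\in V$, $R(u,v)=\{u,v\}$ if and only if $uv\in E(G)$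 (that is, $G$ is the underlying graph of $R$). -/

import Mathlib

/-- A transit function on `V`: a map `R` from pairs of points to subsets with
(t1) `u ∈ R(u,v)`, (t2) `R(u,v) = R(v,u)`, (t3) `R(u,u) = {u}`. -/
structure IsTransitFunction {V : Type*} (R : V → V → Set V) : Prop where
  t1 : ∀ u v, u ∈ R u v
  t2 : ∀ u v, R u v = R v u
  t3 : ∀ u, R u u = {u}

/-- Axiom (b3). -/
def AxiomB3 {V : Type*} (R : V → V → Set V) : Prop :=
  ∀ u v x y, x ∈ R u v → y ∈ R u x → x ∈ R y v

/-- Axiom (J0), for pairwise distinct `u, v, x, y`. -/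
def AxiomJ0 {V : Type*} (R : V → V → Set V) : Prop :=
  ∀ u v x y, u ≠ v → u ≠ x → u ≠ y → v ≠ x → v ≠ y → x ≠ y →
    x ∈ R u y → y ∈ R x v → x ∈ R u v

/-- Axiom (J2). -/
def AxiomJ2 {V : Type*} (R : V → V → Set V) : Prop :=
  ∀ u v x, R u x = {u, x} → R x v = {x, v} → R u v ≠ {u, v} → x ∈ R u v

/-- The interval function `I_G` (used for connected `G`). -/
def intervalFunction {V : Type*} (G : SimpleGraph V) (u v : V) : Set V :=
  {w | G.dist u w + G.dist w v = G.dist u v}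

/-- `G` has no induced cycle of length greater than three. -/
def IsChordalGraph {V : Type*} (G : SimpleGraph V) : Prop :=
  ∀ n : ℕ, 3 < n → ¬ (SimpleGraph.cycleGraph n).IsIndContained G

/-- Distances in every connected induced subgraph agree with the distances in `G`. -/
def IsDistanceHereditary {V : Type*} (G : SimpleGraph V) : Prop :=
  ∀ S : Set V, (G.induce S).Connected →
    ∀ u v : S, (G.induce S).dist u v = G.dist (u : V) (v : V)

/-- A Ptolemaic graph is a chordal distance hereditary graph. -/
def IsPtolemaicGraph {V : Type*} (G : SimpleGraph V) : Prop :=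
  IsChordalGraph G ∧ IsDistanceHereditary G

/-! In any connected graph `I_G` satisfies (b3), (J2) and the edge condition. For (J0), shortest
paths u–x, x–y, y–v are concatenated: the hypotheses make u–y and x–v geodesic, chordality excludes
chords, so the whole path is induced (`isInducedPath_of_isChordalGraph`), and distance heredity
makes it a shortest u–v path through x.

Conversely, (J2) and (J0) place all vertices of a locally induced path in `R` of its ends
(`IsLocallyInducedPath.mem_transit`). A long induced cycle minus an edge would be such a path with
adjacent ends, so `G` is chordal; shortest paths give `I_G ⊆ R`. Adding (b3) makes every induced
path shortest (`IsInducedPath.dist_eq`), hence distance heredity. Finally, if x ∈ R(u,v), shortest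
u–x and x–v paths join to an induced path, so `R ⊆ I_G`. -/

namespace SimpleGraph

variable {V : Type*} {G : SimpleGraph V} {f g : ℕ → V} {n : ℕ}

/-! ### Induced paths, geodesics and concatenation -/

/-- `f 0, …, f n` is an induced path of `G`. -/
structure IsInducedPath (G : SimpleGraph V) (f : ℕ → V) (n : ℕ) : Prop where
  adj : ∀ i, i < n → G.Adj (f i) (f (i + 1))
  ne : ∀ i j, i + 2 ≤ j → j ≤ n → f i ≠ f j
  not_adj : ∀ i j, i + 2 ≤ j → j ≤ n → ¬ G.Adj (f i) (f j)

/-- `f 0, …, f n` is a path of `G` each of whose subpaths of length two is induced. -/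
structure IsLocallyInducedPath (G : SimpleGraph V) (f : ℕ → V) (n : ℕ) : Prop where
  adj : ∀ i, i < n → G.Adj (f i) (f (i + 1))
  ne : ∀ i j, i < j → j ≤ n → f i ≠ f j
  not_adj : ∀ i, i + 2 ≤ n → ¬ G.Adj (f i) (f (i + 2))

/-- `f 0, …, f n` is a shortest path of `G`. -/
def IsGeodesic (G : SimpleGraph V) (f : ℕ → V) (n : ℕ) : Prop :=
  ∀ i j, i ≤ j → j ≤ n → G.dist (f i) (f j) + i = j

theorem IsInducedPath.isLocallyInducedPath (h : G.IsInducedPath f n) :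
    G.IsLocallyInducedPath f n where
  adj := h.adj
  ne i j hij hj := by
    rcases Nat.lt_or_ge j (i + 2) with h2 | h2
    · obtain rfl : j = i + 1 := by omega
      exact (h.adj i (by omega)).ne
    · exact h.ne i j h2 hj
  not_adj i hi := h.not_adj i (i + 2) le_rfl hi

theorem IsInducedPath.tail (h : G.IsInducedPath f (n + 1)) :
    G.IsInducedPath (fun i => f (i + 1)) n where
  adj i hi := h.adj (i + 1) (by omega)
  ne i j hij hj := h.ne (i + 1) (j + 1) (by omega) (by omega)
  not_adj i j hij hj := h.not_adj (i + 1) (j + 1) (by omega) (by omega)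

theorem IsGeodesic.adj (h : G.IsGeodesic f n) (i : ℕ) (hi : i < n) : G.Adj (f i) (f (i + 1)) :=
  dist_eq_one_iff_adj.mp (by have := h i (i + 1) (by omega) (by omega); omega)

theorem IsGeodesic.isInducedPath (h : G.IsGeodesic f n) : G.IsInducedPath f n where
  adj := h.adj
  ne i j hij hj he := by
    have := h i j (by omega) hj
    rw [he, dist_self] at this
    omega
  not_adj i j hij hj ha := by
    have := h i j (by omega) hj
    rw [dist_eq_one_iff_adj.mpr ha] at this
    omega

theorem Connected.dist_add_le_of_adj (hG : G.Connected)
    (h : ∀ i, i < n → G.Adj (f i) (f (i + 1))) (i j : ℕ) (hij : i ≤ j) (hj : j ≤ n) :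
    G.dist (f i) (f j) + i ≤ j := by
  induction j, hij using Nat.le_induction with
  | base => simp
  | succ j hij ih =>
    have h1 := ih (by omega)
    have h2 := hG.dist_triangle (u := f i) (v := f j) (w := f (j + 1))
    rw [dist_eq_one_iff_adj.mpr (h j (by omega))] at h2
    omega

/-- The segments before `i`, from `i` to `j` and after `j` span at most their lengths but together
at least `n`, so each bound is tight. -/
theorem Connected.isGeodesic_of_adj (hG : G.Connected)
    (h : ∀ i, i < n → G.Adj (f i) (f (i + 1))) (hn : n ≤ G.dist (f 0) (f n)) :
    G.IsGeodesic f n := by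
  intro i j hij hj
  have h1 := hG.dist_add_le_of_adj h 0 i (by omega) (by omega)
  have h2 := hG.dist_add_le_of_adj h i j hij hj
  have h3 := hG.dist_add_le_of_adj h j n hj le_rfl
  have h4 := hG.dist_triangle (u := f 0) (v := f i) (w := f n)
  have h5 := hG.dist_triangle (u := f i) (v := f j) (w := f n)
  omega

theorem Connected.exists_isGeodesic (hG : G.Connected) (u v : V) :
    ∃ f, G.IsGeodesic f (G.dist u v) ∧ f 0 = u ∧ f (G.dist u v) = v := by
  obtain ⟨p, hp⟩ := hG.exists_walk_length_eq_dist u v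
  have h1 : p.getVert (G.dist u v) = v := by rw [← hp, p.getVert_length]
  refine ⟨p.getVert, hG.isGeodesic_of_adj (fun i hi => p.adj_getVert_succ (by omega)) ?_,
    p.getVert_zero, h1⟩
  rw [h1, p.getVert_zero]

/-- The sequence that follows `f` up to index `a` and `g` afterwards. -/
def joinAt (f g : ℕ → V) (a i : ℕ) : V := if i ≤ a then f i else g (i - a)

theorem joinAt_of_le {a i : ℕ} (h : i ≤ a) : joinAt f g a i = f i := if_pos h

theorem joinAt_add {a : ℕ} (h : f a = g 0) (i : ℕ) : joinAt f g a (a + i) = g i := by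
  rcases Nat.eq_zero_or_pos i with rfl | hi
  · rw [joinAt_of_le (by omega), Nat.add_zero, h]
  · rw [joinAt, if_neg (by omega), Nat.add_sub_cancel_left]

theorem joinAt_adj {a b : ℕ} (hf : ∀ i, i < a → G.Adj (f i) (f (i + 1)))
    (hg : ∀ i, i < b → G.Adj (g i) (g (i + 1))) (h : f a = g 0) (i : ℕ) (hi : i < a + b) :
    G.Adj (joinAt f g a i) (joinAt f g a (i + 1)) := by
  rcases Nat.lt_or_ge i a with h1 | h1
  · rw [joinAt_of_le h1.le, joinAt_of_le h1]
    exact hf i h1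
  · obtain ⟨k, rfl⟩ := Nat.exists_eq_add_of_le h1
    rw [Nat.add_assoc, joinAt_add h, joinAt_add h]
    exact hg k (by omega)

/-! ### Induced cycles, chordality and distance heredity -/

theorem cycleGraph_adj_of_lt {i j : Fin n} (hij : i < j) :
    (cycleGraph n).Adj i j ↔ j.val = i.val + 1 ∨ (i.val = 0 ∧ j.val + 1 = n) := by
  have h1 := Fin.coe_sub_iff_lt.mpr hij
  have h2 := Fin.sub_val_of_le hij.le
  have h3 : i.val < j.val := hij
  rw [cycleGraph_adj', h1, h2]
  omega

/-- A path of length at least three whose only chord joins its ends spans an induced cycle. -/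
theorem cycleGraph_isIndContained_of_path (hadj : ∀ i, i < n → G.Adj (f i) (f (i + 1)))
    (hends : G.Adj (f n) (f 0))
    (hne : ∀ i j, i + 2 ≤ j → j ≤ n → ¬ (i = 0 ∧ j = n) → f i ≠ f j ∧ ¬ G.Adj (f i) (f j)) :
    (cycleGraph (n + 1)).IsIndContained G := by
  have key : ∀ i j : Fin (n + 1), i < j →
      f i ≠ f j ∧ (G.Adj (f i) (f j) ↔ (cycleGraph (n + 1)).Adj i j) := by
    intro i j hij
    rw [cycleGraph_adj_of_lt hij]
    have hij' : i.val < j.val := hij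
    have hj := j.isLt
    by_cases h1 : j.val = i.val + 1
    · have := hadj i.val (by omega)
      rw [h1]
      exact ⟨this.ne, by simp [this]⟩
    · by_cases h2 : i.val = 0 ∧ j.val = n
      · rw [h2.1, h2.2]
        exact ⟨hends.ne', by simp [hends.symm]⟩
      · have := hne i.val j.val (by omega) (by omega) h2
        exact ⟨this.1, iff_of_false this.2 (by omega)⟩
  refine ⟨⟨⟨fun i => f i, fun i j h => ?_⟩, fun {i j} => ?_⟩⟩
  · rcases lt_trichotomy i j with hij | hij | hij
    · exact absurd h (key i j hij).1
    · exact hij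
    · exact absurd h.symm (key j i hij).1
  · change G.Adj (f i) (f j) ↔ _
    rcases lt_trichotomy i j with hij | rfl | hij
    · exact (key i j hij).2
    · simp
    · rw [G.adj_comm, (key j i hij).2, adj_comm]

/-- Dropping the closing edge leaves a path with adjacent ends, hence only locally induced.
Reduction mod `n` just makes the sequence total. -/
theorem isLocallyInducedPath_of_cycleGraph_embedding (hn : 4 ≤ n) (e : cycleGraph n ↪g G) :
    G.IsLocallyInducedPath (fun i => e ⟨i % n, Nat.mod_lt _ (by omega)⟩) (n - 1) where
  adj i hi := by
    rw [e.map_adj_iff, cycleGraph_adj_of_lt]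
    · simp only [Nat.mod_eq_of_lt (show i < n by omega), Nat.mod_eq_of_lt (show i + 1 < n by omega)]
      simp
    · simp only [Nat.mod_eq_of_lt (show i < n by omega), Nat.mod_eq_of_lt (show i + 1 < n by omega),
        Fin.mk_lt_mk]
      omega
  ne i j hij hj h := by
    have := e.injective h
    rw [Fin.mk.injEq, Nat.mod_eq_of_lt (by omega), Nat.mod_eq_of_lt (by omega)] at this
    omega
  not_adj i hi := by
    rw [e.map_adj_iff, cycleGraph_adj_of_lt]
    · simp only [Nat.mod_eq_of_lt (show i < n by omega), Nat.mod_eq_of_lt (show i + 2 < n by omega)]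
      omega
    · simp only [Nat.mod_eq_of_lt (show i < n by omega), Nat.mod_eq_of_lt (show i + 2 < n by omega),
        Fin.mk_lt_mk]
      omega

/-- In a distance hereditary graph induced paths are shortest paths. -/
theorem IsInducedPath.le_dist_of_isDistanceHereditary (hD : IsDistanceHereditary G)
    (h : G.IsInducedPath f n) : n ≤ G.dist (f 0) (f n) := by
  set S : Set V := {x | ∃ i, i ≤ n ∧ f i = x}
  have hreach : ∀ i (hi : i ≤ n),
      (G.induce S).Reachable ⟨f 0, 0, Nat.zero_le _, rfl⟩ ⟨f i, i, hi, rfl⟩ := by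
    intro i
    induction i with
    | zero => exact fun _ => Reachable.refl _
    | succ i ih =>
      intro hi
      refine (ih (by omega)).trans (Adj.reachable ?_)
      exact h.adj i hi
  have hconn : (G.induce S).Connected := by
    refine connected_iff_exists_forall_reachable _ |>.mpr ⟨⟨f 0, 0, Nat.zero_le _, rfl⟩, ?_⟩
    rintro ⟨_, i, hi, rfl⟩
    exact hreach i hi
  -- Each edge inside `S` raises the path index by at most one, since the path has no chords.
  have hwalk : ∀ (a b : S) (p : (G.induce S).Walk a b) (i j : ℕ), i ≤ n → j ≤ n →
      f i = a → f j = b → j ≤ i + p.length := by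
    intro a b p
    induction p with
    | @nil a =>
      intro i j hi hj hia hja
      by_contra hlt
      exact h.isLocallyInducedPath.ne i j (by simpa using hlt) hj (hia.trans hja.symm)
    | @cons a c b hac p ih =>
      intro i j hi hj hia hja
      obtain ⟨k, hk, hkc⟩ := c.2
      have h1 := ih k j hk hj hkc hja
      have h2 : k < i + 2 := by
        by_contra hlt
        apply h.not_adj i k (by omega) hk
        rw [hia, hkc]
        exact hac
      rw [Walk.length_cons]
      omega
  rw [← hD S hconn ⟨f 0, 0, Nat.zero_le _, rfl⟩ ⟨f n, n, le_rfl, rfl⟩]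
  obtain ⟨p, hp⟩ := hconn.exists_walk_length_eq_dist
    ⟨f 0, 0, Nat.zero_le _, rfl⟩ ⟨f n, n, le_rfl, rfl⟩
  rw [← hp]
  simpa using hwalk _ _ p 0 n (Nat.zero_le _) le_rfl rfl rfl

/-- If induced paths are shortest paths then `G` is distance hereditary. -/
theorem isDistanceHereditary_of_dist_eq
    (h : ∀ (f : ℕ → V) (n : ℕ), G.IsInducedPath f n → G.dist (f 0) (f n) = n) :
    IsDistanceHereditary G := by
  intro S hS u v
  obtain ⟨f, hf, h0, h1⟩ := hS.exists_isGeodesic u v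
  have hp := hf.isInducedPath
  have := h (fun i => (f i : V)) _ ⟨fun i hi => hp.adj i hi,
    fun i j hij hj he => hp.ne i j hij hj (Subtype.ext he), fun i j hij hj => hp.not_adj i j hij hj⟩
  rw [← this, h0, h1]

/-- In a chordal graph two overlapping shortest paths join to an induced path. -/
theorem isInducedPath_of_isChordalGraph (hC : IsChordalGraph G) {a b c : ℕ} (hb : 0 < b)
    (h1 : G.IsGeodesic f (a + b)) (h2 : G.IsGeodesic (fun i => f (a + i)) (b + c)) :
    G.IsInducedPath f (a + b + c) := by
  have hadj : ∀ i, i < a + b + c → G.Adj (f i) (f (i + 1)) := by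
    intro i hi
    rcases Nat.lt_or_ge i a with hia | hia
    · exact h1.adj i (by omega)
    · obtain ⟨k, rfl⟩ := Nat.exists_eq_add_of_le hia
      exact h2.adj k (by omega)
  have key : ∀ m i j, j = i + m → 2 ≤ m → j ≤ a + b + c → f i ≠ f j ∧ ¬ G.Adj (f i) (f j) := by
    intro m
    induction m using Nat.strong_induction_on with
    | _ m ih =>
      intro i j hij hm hj
      by_cases hjab : j ≤ a + b
      · exact ⟨h1.isInducedPath.ne i j (by omega) hjab,
          h1.isInducedPath.not_adj i j (by omega) hjab⟩
      by_cases hia : a ≤ i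
      · obtain ⟨k, rfl⟩ := Nat.exists_eq_add_of_le hia
        obtain ⟨l, rfl⟩ := Nat.exists_eq_add_of_le (show a ≤ j by omega)
        exact ⟨h2.isInducedPath.ne k l (by omega) (by omega),
          h2.isInducedPath.not_adj k l (by omega) (by omega)⟩
      -- Now `i < a` and `a + b < j`, so `0 < b` gives `3 ≤ m`. A coincidence would create a chord
      -- of gap `m - 1`; a chord of minimal gap closes an induced cycle on `m + 1 ≥ 4` vertices.
      constructor
      · intro he
        refine (ih (m - 1) (by omega) i (j - 1) (by omega) (by omega) (by omega)).2 ?_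
        have := hadj (j - 1) (by omega)
        rw [Nat.sub_add_cancel (by omega), ← he] at this
        exact this.symm
      · intro he
        apply hC (m + 1) (by omega)
        refine cycleGraph_isIndContained_of_path (f := fun k => f (i + k))
          (fun k hk => hadj (i + k) (by omega)) ?_ ?_
        · rw [hij] at he
          exact he.symm
        · intro k l hkl hl hne
          exact ih (l - k) (by omega) (i + k) (i + l) (by omega) (by omega) (by omega)
  exact ⟨hadj, fun i j hij hj => (key (j - i) i j (by omega) (by omega) hj).1,
    fun i j hij hj => (key (j - i) i j (by omega) (by omega) hj).2⟩

/-! ### The interval function satisfies the axioms -/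

theorem Connected.axiomB3_intervalFunction (hG : G.Connected) :
    AxiomB3 (intervalFunction G) := by
  intro u v x y hx hy
  simp only [intervalFunction, Set.mem_ofPred_eq] at *
  have h1 := hG.dist_triangle (u := u) (v := y) (w := v)
  have h2 := hG.dist_triangle (u := y) (v := x) (w := v)
  omega

theorem Connected.axiomJ0_intervalFunction (hG : G.Connected) (hP : IsPtolemaicGraph G) :
    AxiomJ0 (intervalFunction G) := by
  intro u v x y _ _ _ _ _ hxy hx hy
  simp only [intervalFunction, Set.mem_ofPred_eq] at *
  obtain ⟨f, hf, hf0, hf1⟩ := hG.exists_isGeodesic u x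
  obtain ⟨g, hg, hg0, hg1⟩ := hG.exists_isGeodesic x y
  obtain ⟨k, hk, hk0, hk1⟩ := hG.exists_isGeodesic y v
  set a := G.dist u x
  set b := G.dist x y
  set c := G.dist y v
  have hb : 0 < b := hG.pos_dist_of_ne hxy
  have hgk : g b = k 0 := hg1.trans hk0.symm
  have hfg : f a = joinAt g k b 0 := by rw [joinAt_of_le (Nat.zero_le _), hf1, hg0]
  have hgkadj := joinAt_adj hg.adj hk.adj hgk
  set p := joinAt f (joinAt g k b) a
  have hp : ∀ i, p (a + i) = joinAt g k b i := joinAt_add hfg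
  have hpadj : ∀ i, i < a + (b + c) → G.Adj (p i) (p (i + 1)) := joinAt_adj hf.adj hgkadj hfg
  have hp0 : p 0 = u := by rw [← hf0]; exact joinAt_of_le (Nat.zero_le _)
  have hpx : p a = x := by rw [← hf1]; exact joinAt_of_le le_rfl
  have hpy : p (a + b) = y := by rw [hp, joinAt_of_le le_rfl, hg1]
  have hpv : p (a + b + c) = v := by rw [Nat.add_assoc, hp, joinAt_add hgk, hk1]
  have g1 : G.IsGeodesic p (a + b) :=
    hG.isGeodesic_of_adj (fun i hi => hpadj i (by omega)) (by rw [hp0, hpy]; omega)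
  have g2 : G.IsGeodesic (fun i => p (a + i)) (b + c) :=
    hG.isGeodesic_of_adj (fun i hi => hpadj (a + i) (by omega))
      (by rw [Nat.add_zero, ← Nat.add_assoc, hpx, hpv]; omega)
  have h1 := (isInducedPath_of_isChordalGraph hP.1 hb g1 g2).le_dist_of_isDistanceHereditary hP.2
  rw [hp0, hpv] at h1
  have h2 := hG.dist_triangle (u := u) (v := x) (w := v)
  omega

theorem Connected.intervalFunction_eq_pair_iff (hG : G.Connected) {u v : V} (huv : u ≠ v) :
    intervalFunction G u v = {u, v} ↔ G.Adj u v := by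
  constructor
  · intro h
    obtain ⟨f, hf, hf0, hf1⟩ := hG.exists_isGeodesic u v
    have hpos := hG.pos_dist_of_ne huv
    have h1 := hf 0 1 (by omega) (by omega)
    have h2 := hf 1 (G.dist u v) (by omega) le_rfl
    rw [hf0] at h1
    rw [hf1] at h2
    have h3 : f 1 ∈ intervalFunction G u v := by
      simp only [intervalFunction, Set.mem_ofPred_eq]
      omega
    rw [h] at h3
    rcases h3 with h3 | h3
    · rw [h3, dist_self] at h1
      omega
    · rw [h3] at h1
      exact dist_eq_one_iff_adj.mp (by omega)
  · intro h
    ext w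
    have h1 := dist_eq_one_iff_adj.mpr h
    simp only [intervalFunction, Set.mem_ofPred_eq, Set.mem_insert_iff, Set.mem_singleton_iff, h1]
    constructor
    · intro hw
      rcases Nat.eq_zero_or_pos (G.dist u w) with h0 | h0
      · exact Or.inl (hG.dist_eq_zero_iff.mp h0).symm
      · exact Or.inr (hG.dist_eq_zero_iff.mp (by omega))
    · rintro (rfl | rfl) <;> simp [h1]

theorem Connected.axiomJ2_intervalFunction (hG : G.Connected) :
    AxiomJ2 (intervalFunction G) := by
  intro u v x hux hxv huv
  by_cases h1 : u = x
  · exact absurd (h1 ▸ hxv) huv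
  by_cases h2 : x = v
  · exact absurd (h2 ▸ hux) huv
  rw [hG.intervalFunction_eq_pair_iff h1] at hux
  rw [hG.intervalFunction_eq_pair_iff h2] at hxv
  by_cases h3 : u = v
  · subst h3
    refine absurd ?_ huv
    ext w
    simp only [intervalFunction, Set.mem_ofPred_eq, dist_self, Set.mem_insert_iff,
      Set.mem_singleton_iff, or_self, Nat.add_eq_zero_iff, hG.dist_eq_zero_iff]
    exact ⟨fun h => h.2, fun h => ⟨h.symm, h⟩⟩
  rw [Ne, hG.intervalFunction_eq_pair_iff h3, ← dist_eq_one_iff_adj] at huv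
  have h4 := hG.pos_dist_of_ne h3
  have h5 := hG.dist_triangle (u := u) (v := x) (w := v)
  simp only [intervalFunction, Set.mem_ofPred_eq]
  rw [dist_eq_one_iff_adj.mpr hux, dist_eq_one_iff_adj.mpr hxv] at *
  omega

/-! ### From the axioms to Ptolemaic graphs -/

section TransitFunction

variable {R : V → V → Set V}

/-- The vertices of a locally induced path lie between its ends. -/
theorem IsLocallyInducedPath.mem_transit (hR : IsTransitFunction R) (hJ0 : AxiomJ0 R)
    (hJ2 : AxiomJ2 R) (hE : ∀ u v : V, u ≠ v → (R u v = {u, v} ↔ G.Adj u v))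
    (h : G.IsLocallyInducedPath f n) (m a i : ℕ) (hai : a ≤ i) (him : i ≤ a + m)
    (hm : a + m ≤ n) : f i ∈ R (f a) (f (a + m)) := by
  induction m using Nat.strong_induction_on generalizing a i with
  | _ m ih =>
    rcases hai.eq_or_lt with rfl | hai
    · exact hR.t1 _ _
    rcases him.eq_or_lt with rfl | him
    · rw [hR.t2]
      exact hR.t1 _ _
    obtain ⟨l, rfl⟩ := Nat.exists_eq_add_of_le (show 2 ≤ m by omega)
    rcases Nat.eq_zero_or_pos l with rfl | hl
    · obtain rfl : i = a + 1 := by omega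
      refine hJ2 _ _ _ ((hE _ _ (h.adj a (by omega)).ne).mpr (h.adj a (by omega)))
        ((hE _ _ (h.adj (a + 1) (by omega)).ne).mpr (h.adj (a + 1) (by omega))) ?_
      rw [Ne, hE _ _ (h.ne a (a + 2) (by omega) hm)]
      exact h.not_adj a hm
    -- Induction applies to the subpaths from `a` to `k` and from `j` to the end; (J0) then captures
    -- `f j`, and its mirror image `f k`. Length at least three supplies a second interior vertex.
    have hJ : ∀ j k, a < j → j < k → k < a + (2 + l) →
        f j ∈ R (f a) (f (a + (2 + l))) ∧ f k ∈ R (f a) (f (a + (2 + l))) := by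
      intro j k haj hjk hkl
      obtain ⟨r, hr⟩ := Nat.exists_eq_add_of_le (show a ≤ k by omega)
      obtain ⟨s, hs⟩ := Nat.exists_eq_add_of_le (show j ≤ a + (2 + l) by omega)
      have h1 := ih r (by omega) a j (by omega) (by omega) (by omega)
      have h2 := ih s (by omega) j k (by omega) (by omega) (by omega)
      rw [← hr] at h1
      rw [← hs] at h2
      have n1 := h.ne a (a + (2 + l)) (by omega) hm
      have n2 := h.ne a j (by omega) (by omega)
      have n3 := h.ne a k (by omega) (by omega)
      have n4 := h.ne j (a + (2 + l)) (by omega) hm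
      have n5 := h.ne k (a + (2 + l)) (by omega) hm
      have n6 := h.ne j k (by omega) (by omega)
      refine ⟨hJ0 _ _ _ _ n1 n2 n3 n4.symm n5.symm n6 h1 h2, ?_⟩
      rw [hR.t2] at h1 h2 ⊢
      exact hJ0 _ _ _ _ n1.symm n5.symm n4.symm n3 n2 n6.symm h2 h1
    rcases Nat.lt_or_ge (i + 1) (a + (2 + l)) with h1 | h1
    · exact (hJ i (i + 1) hai (by omega) h1).1
    · exact (hJ (a + 1) i (by omega) (by omega) him).2

theorem IsLocallyInducedPath.mem_transit_ends (hR : IsTransitFunction R) (hJ0 : AxiomJ0 R)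
    (hJ2 : AxiomJ2 R) (hE : ∀ u v : V, u ≠ v → (R u v = {u, v} ↔ G.Adj u v))
    (h : G.IsLocallyInducedPath f n) (i : ℕ) (hi : i ≤ n) : f i ∈ R (f 0) (f n) := by
  simpa using h.mem_transit hR hJ0 hJ2 hE n 0 i (by omega) (by omega) (by omega)

theorem isChordalGraph_of_transit (hR : IsTransitFunction R) (hJ0 : AxiomJ0 R)
    (hJ2 : AxiomJ2 R) (hE : ∀ u v : V, u ≠ v → (R u v = {u, v} ↔ G.Adj u v)) :
    IsChordalGraph G := by
  rintro n hn ⟨e⟩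
  have h := isLocallyInducedPath_of_cycleGraph_embedding hn e
  have h1 := h.mem_transit_ends hR hJ0 hJ2 hE 1 (by omega)
  have hadj : G.Adj (e ⟨0 % n, Nat.mod_lt _ (by omega)⟩)
      (e ⟨(n - 1) % n, Nat.mod_lt _ (by omega)⟩) := by
    rw [e.map_adj_iff, cycleGraph_adj_of_lt]
    · simp only [Nat.zero_mod, Nat.mod_eq_of_lt (show n - 1 < n by omega)]
      exact Or.inr ⟨trivial, by omega⟩
    · simp only [Nat.zero_mod, Nat.mod_eq_of_lt (show n - 1 < n by omega), Fin.mk_lt_mk]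
      omega
  rw [(hE _ _ hadj.ne).mpr hadj] at h1
  rcases h1 with h1 | h1
  · exact h.ne 0 1 (by omega) (by omega) h1.symm
  · exact h.ne 1 (n - 1) (by omega) le_rfl h1

theorem Connected.intervalFunction_subset_transit (hG : G.Connected) (hR : IsTransitFunction R)
    (hJ0 : AxiomJ0 R) (hJ2 : AxiomJ2 R)
    (hE : ∀ u v : V, u ≠ v → (R u v = {u, v} ↔ G.Adj u v)) (u v : V) :
    intervalFunction G u v ⊆ R u v := by
  intro x hx
  simp only [intervalFunction, Set.mem_ofPred_eq] at hx
  obtain ⟨f, hf, hf0, hf1⟩ := hG.exists_isGeodesic u x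
  obtain ⟨g, hg, hg0, hg1⟩ := hG.exists_isGeodesic x v
  set a := G.dist u x
  set b := G.dist x v
  have hfg : f a = g 0 := hf1.trans hg0.symm
  have hp0 : joinAt f g a 0 = u := by rw [joinAt_of_le (Nat.zero_le _), hf0]
  have hpx : joinAt f g a a = x := by rw [joinAt_of_le le_rfl, hf1]
  have hpv : joinAt f g a (a + b) = v := by rw [joinAt_add hfg, hg1]
  have hp : G.IsGeodesic (joinAt f g a) (a + b) :=
    hG.isGeodesic_of_adj (joinAt_adj hf.adj hg.adj hfg) (by rw [hp0, hpv]; omega)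
  have := hp.isInducedPath.isLocallyInducedPath.mem_transit_ends hR hJ0 hJ2 hE a (by omega)
  rwa [hpx, hp0, hpv] at this

/-- Two distinct vertices cannot each lie between the other one and a common third vertex. -/
theorem eq_of_mem_transit (hR : IsTransitFunction R) (hb3 : AxiomB3 R) {u v x : V}
    (h1 : x ∈ R u v) (h2 : u ∈ R x v) : u = x := by
  rw [hR.t2] at h1 h2
  have := hb3 _ _ _ _ h2 h1
  rwa [hR.t3] at this

/-- By induction the tail is shortest. Given a shorter geodesic `q` between the ends, `f 1` is put
in front of it, replacing `q 0 = f 0` if `f 1` is adjacent to `q 1`; the resulting locally induced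
path conflicts with `f 1 ∈ R (f 0) (f (k + 1))` through (b3). -/
theorem IsInducedPath.dist_eq (hG : G.Connected) (hR : IsTransitFunction R) (hb3 : AxiomB3 R)
    (hJ0 : AxiomJ0 R) (hJ2 : AxiomJ2 R)
    (hE : ∀ u v : V, u ≠ v → (R u v = {u, v} ↔ G.Adj u v)) (h : G.IsInducedPath f n) :
    G.dist (f 0) (f n) = n := by
  induction n generalizing f with
  | zero => simp
  | succ k ih =>
    have hk := ih h.tail
    simp only [Nat.zero_add] at hk
    have hle := hG.dist_add_le_of_adj h.adj 0 (k + 1) (by omega) le_rfl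
    rcases Nat.eq_zero_or_pos k with rfl | hkpos
    · exact dist_eq_one_iff_adj.mpr (h.adj 0 (by omega))
    obtain ⟨q, hq, hq0, hq1⟩ := hG.exists_isGeodesic (f 0) (f (k + 1))
    set m := G.dist (f 0) (f (k + 1))
    by_contra hlt
    have hm : 2 ≤ m := by
      have h1 := hG.pos_dist_of_ne (h.ne 0 (k + 1) (by omega) le_rfl)
      have h2 := mt dist_eq_one_iff_adj.mp (h.not_adj 0 (k + 1) (by omega) le_rfl)
      omega
    have h01 : G.dist (f 0) (f 1) = 1 := dist_eq_one_iff_adj.mpr (h.adj 0 (by omega))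
    have hfmem : f 1 ∈ R (f 0) (f (k + 1)) :=
      h.isLocallyInducedPath.mem_transit_ends hR hJ0 hJ2 hE 1 (by omega)
    have hqne : ∀ j, j ≤ m → f 1 ≠ q j := by
      intro j hj he
      have h1 := hq 0 j (by omega) hj
      have h2 := hq j m hj le_rfl
      rw [hq0, ← he] at h1
      rw [hq1, ← he] at h2
      omega
    have hqpath := hq.isInducedPath.isLocallyInducedPath
    by_cases hadj : G.Adj (f 1) (q 1)
    · have hfar : ∀ i, 2 ≤ i → i ≤ m → ¬ G.Adj (f 1) (q i) := by
        intro i hi him ha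
        have h1 := hq i m him le_rfl
        have h2 := hG.dist_triangle (u := f 1) (v := q i) (w := q m)
        rw [hq1] at h1 h2
        rw [dist_eq_one_iff_adj.mpr ha] at h2
        omega
      have hpath : G.IsLocallyInducedPath (fun i => if i = 0 then f 1 else q i) m := by
        refine ⟨fun i hi => ?_, fun i j hij hj => ?_, fun i hi => ?_⟩
        · rcases Nat.eq_zero_or_pos i with rfl | h0
          · simpa using hadj
          · simpa [h0.ne'] using hq.adj i hi
        · rcases Nat.eq_zero_or_pos i with rfl | h0
          · simpa [hij.ne'] using hqne j hj
          · simpa [h0.ne', (h0.trans hij).ne'] using hqpath.ne i j hij hj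
        · rcases Nat.eq_zero_or_pos i with rfl | h0
          · simpa using hfar 2 le_rfl hi
          · simpa [h0.ne'] using hqpath.not_adj i hi
      have hmem := hpath.mem_transit_ends hR hJ0 hJ2 hE 1 (by omega)
      simp only [one_ne_zero, if_false, if_true, if_neg (show m ≠ 0 by omega), hq1] at hmem
      rw [hR.t2] at hmem hfmem
      -- This puts `f 1` in `R` of the edge from `q 1` to `f 0`, although it is neither end.
      have h1 := hb3 _ _ _ _ hfmem hmem
      have hq01 : G.Adj (q 1) (f 0) := by
        rw [← hq0]
        exact (hq.adj 0 (by omega)).symm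
      rw [(hE _ _ hq01.ne).mpr hq01] at h1
      rcases h1 with h1 | h1
      · exact hqne 1 (by omega) h1
      · exact (h.adj 0 (by omega)).ne h1.symm
    · have hpath : G.IsLocallyInducedPath (fun i => if i = 0 then f 1 else q (i - 1)) (m + 1) := by
        refine ⟨fun i hi => ?_, fun i j hij hj => ?_, fun i hi => ?_⟩
        · rcases Nat.eq_zero_or_pos i with rfl | h0
          · simpa [hq0] using (h.adj 0 (by omega)).symm
          · obtain ⟨i, rfl⟩ := Nat.exists_eq_add_of_lt h0
            simpa using hq.adj i (by omega)
        · rcases Nat.eq_zero_or_pos i with rfl | h0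
          · simpa [hij.ne'] using hqne (j - 1) (by omega)
          · simpa [h0.ne', (h0.trans hij).ne'] using
              hqpath.ne (i - 1) (j - 1) (by omega) (by omega)
        · rcases Nat.eq_zero_or_pos i with rfl | h0
          · simpa using hadj
          · obtain ⟨i, rfl⟩ := Nat.exists_eq_add_of_lt h0
            simpa using hqpath.not_adj i (by omega)
      have hmem := hpath.mem_transit_ends hR hJ0 hJ2 hE 1 (by omega)
      simp [hq0, hq1] at hmem
      exact (h.adj 0 (by omega)).ne (eq_of_mem_transit hR hb3 hfmem hmem)

theorem Connected.transit_subset_intervalFunction (hG : G.Connected) (hR : IsTransitFunction R)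
    (hb3 : AxiomB3 R) (hJ0 : AxiomJ0 R) (hJ2 : AxiomJ2 R)
    (hE : ∀ u v : V, u ≠ v → (R u v = {u, v} ↔ G.Adj u v)) (u v : V) :
    R u v ⊆ intervalFunction G u v := by
  intro x hx
  obtain ⟨f, hf, hf0, hf1⟩ := hG.exists_isGeodesic u x
  obtain ⟨g, hg, hg0, hg1⟩ := hG.exists_isGeodesic x v
  have hfmem := fun i hi =>
    hf.isInducedPath.isLocallyInducedPath.mem_transit_ends hR hJ0 hJ2 hE i hi
  have hgmem := fun i hi =>
    hg.isInducedPath.isLocallyInducedPath.mem_transit_ends hR hJ0 hJ2 hE i hi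
  rw [hf0, hf1] at hfmem
  rw [hg0, hg1] at hgmem
  simp only [intervalFunction, Set.mem_ofPred_eq]
  set a := G.dist u x
  set b := G.dist x v
  have hfg : f a = g 0 := hf1.trans hg0.symm
  -- Two uses of (b3) shrink `x ∈ R u v` to `x ∈ R (g j) (f i)`; as `x` differs from both, they are
  -- neither equal nor adjacent.
  have cross : ∀ i j, i < a → 0 < j → j ≤ b → f i ≠ g j ∧ ¬ G.Adj (f i) (g j) := by
    intro i j hi hj hjb
    have h1 := hb3 _ _ _ _ hx (hfmem i hi.le)
    have h2 := hgmem j hjb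
    rw [hR.t2] at h1 h2
    have h3 := hb3 _ _ _ _ h1 h2
    have n1 : x ≠ f i := by
      rw [← hf1]
      exact (hf.isInducedPath.isLocallyInducedPath.ne i a hi le_rfl).symm
    have n2 : x ≠ g j := by
      rw [← hg0]
      exact hg.isInducedPath.isLocallyInducedPath.ne 0 j hj hjb
    constructor
    · intro he
      rw [he, hR.t3] at h3
      exact n2 h3
    · intro he
      rw [(hE _ _ he.ne').mpr he.symm] at h3
      exact h3.elim n2 n1
  have key : ∀ i j, i + 2 ≤ j → j ≤ a + b →
      joinAt f g a i ≠ joinAt f g a j ∧ ¬ G.Adj (joinAt f g a i) (joinAt f g a j) := by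
    intro i j hij hj
    rcases Nat.lt_or_ge a j with hja | hja
    · obtain ⟨l, rfl⟩ := Nat.exists_eq_add_of_le hja.le
      rcases Nat.lt_or_ge i a with hia | hia
      · rw [joinAt_add hfg, joinAt_of_le hia.le]
        exact cross i l hia (by omega) (by omega)
      · obtain ⟨k, rfl⟩ := Nat.exists_eq_add_of_le hia
        rw [joinAt_add hfg, joinAt_add hfg]
        exact ⟨hg.isInducedPath.ne k l (by omega) (by omega),
          hg.isInducedPath.not_adj k l (by omega) (by omega)⟩
    · rw [joinAt_of_le hja, joinAt_of_le (show i ≤ a by omega)]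
      exact ⟨hf.isInducedPath.ne i j hij hja, hf.isInducedPath.not_adj i j hij hja⟩
  have hp : G.IsInducedPath (joinAt f g a) (a + b) :=
    ⟨joinAt_adj hf.adj hg.adj hfg, fun i j hij hj => (key i j hij hj).1,
      fun i j hij hj => (key i j hij hj).2⟩
  have := hp.dist_eq hG hR hb3 hJ0 hJ2 hE
  rw [joinAt_of_le (Nat.zero_le _), joinAt_add hfg, hf0, hg1] at this
  exact this.symm

end TransitFunction

end SimpleGraph

theorem mainTheorem2 {V : Type*} [Finite V] (G : SimpleGraph V) (hG : G.Connected)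
    (R : V → V → Set V) (hR : IsTransitFunction R) :
    (IsPtolemaicGraph G ∧ ∀ u v : V, R u v = intervalFunction G u v) ↔
      (AxiomB3 R ∧ AxiomJ0 R ∧ AxiomJ2 R ∧
        ∀ u v : V, u ≠ v → (R u v = {u, v} ↔ G.Adj u v)) := by
  constructor
  · rintro ⟨hP, hI⟩
    obtain rfl : R = intervalFunction G := funext₂ hI
    exact ⟨hG.axiomB3_intervalFunction, hG.axiomJ0_intervalFunction hP,
      hG.axiomJ2_intervalFunction, fun u v huv => hG.intervalFunction_eq_pair_iff huv⟩
  · rintro ⟨hb3, hJ0, hJ2, hE⟩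
    refine ⟨⟨SimpleGraph.isChordalGraph_of_transit hR hJ0 hJ2 hE,
      SimpleGraph.isDistanceHereditary_of_dist_eq
        fun f n h => h.dist_eq hG hR hb3 hJ0 hJ2 hE⟩, fun u v => ?_⟩
    exact (hG.transit_subset_intervalFunction hR hb3 hJ0 hJ2 hE u v).antisymm
      (hG.intervalFunction_subset_transit hR hJ0 hJ2 hE u v)
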